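/- Let $\mathcal H$ be a finite-dimensional Hilbert space and let $\mathscr D(\mathcal H)$ be its set of density operators. For $\rho_1,\rho_2\in\mathscr D(\mathcal H)$ and $\alpha\in[0,1]$ put $Q_\alpha(\rho_1\|\rho_2):=\operatorname{tr}[\rho_1^{\alpha}\rho_2^{1-\alpha}]$, where powers are taken on the support (so $\rho^0$ is the projection onto the support of $\rho$), and $C(\rho_1\|\rho_2):=\max_{\alpha\in[0,1]}-\log Q_\alpha(\rho_1\|\rho_2)\in[0,+\infty]$, with $\log$ to base two and $-\log 0=+\infty$. For sets $\mathscr C_1,\mathscr C_2\subseteq\mathscr D(\mathcal H)$ put $$C(\mathscr C_1\|\mathscr C_2):=\inf_{\rho_1\in\mathscr C_1,\,\rho_2\in\mathscr C_2}C(\rho_1\|\rho_2),\qquad Q_\alpha(\mathscr C_1\|\mathscr C_2):=\sup_{\rho_1\in\mathscr C_1,\,\rho_2\in\mathscr C_2}Q_\alpha(\rho_1\|\rho_2)$$ (if one of the sets is empty, the infimum is $+\infty$ and the supremum is $0$). (1) If $\mathscr C_1,\mathscr C_2\subseteq\mathscr D(\mathcal H)$ are convex, then $$C(\mathscr C_1\|\mathscr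 C_2)=\max_{\alpha\in[0,1]}-\log Q_\alpha(\mathscr C_1\|\mathscr C_2),$$ and in particular the maximum is attained. (2) Let $\mathscr C_i=\{\mathscr C_{i,n}\}_{n\ge1}$, $i=1,2$, be two sequences of convex sets $\mathscr C_{i,n}\subseteq\mathscr D(\mathcal H^{\otimes n})$ that are stable under tensor products, i.e. $X\otimes Y\in\mathscr C_{i,n+m}$ whenever $X\in\mathscr C_{i,n}$, $Y\in\mathscr C_{i,m}$ and $n,m\ge1$. Define, when the limits exist in $[0,+\infty]$, $$C^\infty(\mathscr C_1\|\mathscr C_2):=\lim_{n\to\infty}\tfrac1n C(\mathscr C_{1,n}\|\mathscr C_{2,n}),\qquad Q^\infty_\alpha(\mathscr C_1\|\mathscr C_2):=\lim_{n\to\infty}\big[Q_\alpha(\mathscr C_{1,n}\|\mathscr C_{2,n})\big]^{1/n},$$ and let $\underline C^\infty$ and $\overline Q{}^\infty_\alpha$ denote the same expressions with $\liminf$, respectively $\limsup$, in place of $\lim$. (a) The limit $C^\infty(\mathscr C_1\|\mathscr C_2)$ exists if and only if $C(\mathscr C_{1,n}\|\mathscr C_{2,n})$ is finite for all sufficiently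 large $n$ or is $+\infty$ for all $n\ge1$. (b) If $C^\infty(\mathscr C_1\|\mathscr C_2)$ exists, then $Q^\infty_\alpha(\mathscr C_1\|\mathscr C_2)$ exists for every $\alpha\in[0,1]$, and $$C^\infty(\mathscr C_1\|\mathscr C_2)=\max_{\alpha\in[0,1]}-\log Q^\infty_\alpha(\mathscr C_1\|\mathscr C_2).$$ (c) In all cases $$\underline C^\infty(\mathscr C_1\|\mathscr C_2)=\max_{\alpha\in[0,1]}-\log\overline Q{}^\infty_\alpha(\mathscr C_1\|\mathscr C_2).$$ -/

import Mathlib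

open Set Filter Topology
open scoped ENNReal Kronecker ComplexOrder

noncomputable section

namespace QChernoff

/-- The density matrices on the Hilbert space `ℂ^κ`: positive semidefinite with unit trace. -/
def density (κ : Type*) [Fintype κ] : Set (Matrix κ κ ℂ) :=
  {ρ | ρ.PosSemidef ∧ ρ.trace = 1}

/-- The power `A ^ s` of a positive semidefinite matrix, taken on the support of `A`: each nonzero
eigenvalue `x` is replaced by `x ^ s`, and the eigenvalue `0` stays `0`.
In particular `A ^ 0` is the projection onto the support of `A`. -/
def psdPow {κ : Type*} [Fintype κ] [DecidableEq κ] (A : Matrix κ κ ℂ) (s : ℝ) : Matrix κ κ ℂ :=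
  cfc (fun x : ℝ => if x = 0 then 0 else x ^ s) A

/-- `-log₂ x` as an extended real, with `-log₂ 0 = ⊤`. -/
def negLog2 (x : ℝ≥0∞) : EReal :=
  -(ENNReal.log x / ((Real.log 2 : ℝ) : EReal))

/-- `Q_α(ρ₁‖ρ₂) = tr[ρ₁^α ρ₂^(1-α)]`, a nonnegative real number for positive semidefinite
`ρ₁`, `ρ₂`, regarded as an element of `[0, ∞]`. -/
def stateQ {κ : Type*} [Fintype κ] [DecidableEq κ] (α : ℝ) (ρ₁ ρ₂ : Matrix κ κ ℂ) : ℝ≥0∞ :=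
  ENNReal.ofReal (Matrix.trace (psdPow ρ₁ α * psdPow ρ₂ (1 - α))).re

/-- The quantum Chernoff divergence of two states, with values in the extended reals. -/
def stateC {κ : Type*} [Fintype κ] [DecidableEq κ] (ρ₁ ρ₂ : Matrix κ κ ℂ) : EReal :=
  ⨆ α ∈ Icc (0 : ℝ) 1, negLog2 (stateQ α ρ₁ ρ₂)

/-- The quantum Chernoff quasi-divergence between two sets of states. -/
def setQ {κ : Type*} [Fintype κ] [DecidableEq κ] (α : ℝ) (C₁ C₂ : Set (Matrix κ κ ℂ)) : ℝ≥0∞ :=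
  ⨆ ρ₁ ∈ C₁, ⨆ ρ₂ ∈ C₂, stateQ α ρ₁ ρ₂

/-- The quantum Chernoff divergence between two sets of states. -/
def setC {κ : Type*} [Fintype κ] [DecidableEq κ] (C₁ C₂ : Set (Matrix κ κ ℂ)) : EReal :=
  ⨅ ρ₁ ∈ C₁, ⨅ ρ₂ ∈ C₂, stateC ρ₁ ρ₂

/-- Operators on the `n`-fold tensor power of `ℂ^ι`, written in the product basis, which is
indexed by `Fin n → ι`. -/
abbrev PowMat (ι : Type*) (n : ℕ) : Type _ := Matrix (Fin n → ι) (Fin n → ι) ℂ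

/-- The tensor product of an operator on the `n`-fold tensor power and one on the `m`-fold tensor
power, as an operator on the `(n + m)`-fold tensor power. -/
def tensor {ι : Type*} {n m : ℕ} (X : PowMat ι n) (Y : PowMat ι m) : PowMat ι (n + m) :=
  Matrix.reindex (Fin.appendEquiv n m) (Fin.appendEquiv n m) (X ⊗ₖ Y)

/-- Stability under tensor products of a sequence of sets, indexed by `n ≥ 1`
(the entry at `n = 0` is irrelevant). -/
def Stable {ι : Type*} (C : (n : ℕ) → Set (PowMat ι n)) : Prop :=
  ∀ n m : ℕ, 1 ≤ n → 1 ≤ m → ∀ X ∈ C n, ∀ Y ∈ C m, tensor X Y ∈ C (n + m)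

/-- The sequence `C(C₁ₙ‖C₂ₙ) / n`, whose limit is the regularized Chernoff divergence. -/
def rateC {ι : Type*} [Fintype ι] [DecidableEq ι] (C₁ C₂ : (n : ℕ) → Set (PowMat ι n)) (n : ℕ) :
    EReal :=
  setC (C₁ n) (C₂ n) / (n : EReal)

/-- The sequence `Q_α(C₁ₙ‖C₂ₙ) ^ (1 / n)`, whose limit is the regularized quasi-divergence. -/
def rateQ {ι : Type*} [Fintype ι] [DecidableEq ι] (α : ℝ) (C₁ C₂ : (n : ℕ) → Set (PowMat ι n))
    (n : ℕ) : ℝ≥0∞ :=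
  setQ α (C₁ n) (C₂ n) ^ (1 / (n : ℝ))

/-- `L` is the regularized Chernoff divergence of the two sequences: the limit exists and is `L`. -/
def IsRegC {ι : Type*} [Fintype ι] [DecidableEq ι] (C₁ C₂ : (n : ℕ) → Set (PowMat ι n))
    (L : EReal) : Prop :=
  Tendsto (rateC C₁ C₂) atTop (𝓝 L)

/-- `q` is the regularized quasi-divergence of the two sequences: the limit exists and is `q`. -/
def IsRegQ {ι : Type*} [Fintype ι] [DecidableEq ι] (α : ℝ) (C₁ C₂ : (n : ℕ) → Set (PowMat ι n))
    (q : ℝ≥0∞) : Prop :=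
  Tendsto (rateQ α C₁ C₂) atTop (𝓝 q)

/-- The lower regularized Chernoff divergence (a limit inferior). -/
def lowerRegC {ι : Type*} [Fintype ι] [DecidableEq ι] (C₁ C₂ : (n : ℕ) → Set (PowMat ι n)) :
    EReal :=
  liminf (rateC C₁ C₂) atTop

/-- The upper regularized quasi-divergence (a limit superior). -/
def upperRegQ {ι : Type*} [Fintype ι] [DecidableEq ι] (α : ℝ)
    (C₁ C₂ : (n : ℕ) → Set (PowMat ι n)) : ℝ≥0∞ :=
  limsup (rateQ α C₁ C₂) atTop

end QChernoff

end

/-!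
In eigenbases `(dᵢ)`, `(eⱼ)` of two states, `Q_α` is `∑ᵢⱼ dᵢ ^ α eⱼ ^ (1 - α) |⟨aᵢ, bⱼ⟩|²`, the sum
extending over nonzero eigenvalues. Hence `Q_α` is continuous and convex in `α`, at most one on
density matrices, multiplicative under tensor products, and its vanishing does not depend on `α`.

*One copy.* The divergence of two sets is a minimax problem for `Q_α(ρ₁‖ρ₂)`, which is convex in
`α ∈ [0, 1]` and jointly concave in `(ρ₁, ρ₂)`. Joint concavity (`le_realQ_add_smul`, Lieb's
theorem) is elementary here: up to a positive constant `x ^ α y ^ (1 - α)` is the integral of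
`t ^ (α - 1) * (x y / (x + t y))` over `t > 0`, and the matrix quantity belonging to
`x y / (x + t y)` is the minimum over all matrices `X` of
`t⁻¹ tr[(1 - X)ᴴ A (1 - X)] + tr[X B Xᴴ]`, which is affine in `(A, B)`. The sets of states need be
neither closed nor compact, so that Sion's theorem is applied to convex combinations of finitely
many pairs of states (`exists_forall_le_of_convexOn_concaveOn`).

*Many copies.* Supermultiplicativity of `Q_α` on stable sequences makes `-log₂ Q_α` subadditive, and
by the one-copy identity so is the divergence. For a subadditive sequence `a` in `[0, ∞]` the lower
limit of `a n / n` is always the infimum over `n ≥ 1`, and it is a limit if `a` is eventually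
finite. What remains is `inf_n max_α = max_α inf_n` for the functions `-log₂ Q_α / n`. They are upper
semicontinuous in `α` and decrease along `n = k!`, so the sets of `α` where they are at least the
left-hand side are nonempty, compact and nested (`exists_iInf_div_le_iInf_div`). The limit of the
divergences exists only if these are eventually finite or all infinite; in the latter case `Q_α`
vanishes for all `α` and all `n ≥ 1`, and in both cases the limits of the quasi-divergences exist.
-/

/-! ### Quasi-divergences in eigenbases -/

namespace QChernoff

open Matrix

variable {κ κ' : Type*} [Fintype κ] [DecidableEq κ] [Fintype κ'] [DecidableEq κ']

/-- `A = U diag(d) U⁻¹` with `U` unitary and `d` real. -/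
def Diagonalizes (A U : Matrix κ κ ℂ) (d : κ → ℝ) : Prop :=
  U * Uᴴ = 1 ∧ Uᴴ * U = 1 ∧ A = U * diagonal (fun i => (d i : ℂ)) * Uᴴ

theorem exists_diagonalizes {A : Matrix κ κ ℂ} (hA : A.IsHermitian) :
    ∃ U d, Diagonalizes A U d := by
  refine ⟨hA.eigenvectorUnitary, hA.eigenvalues, ?_, ?_, ?_⟩
  · exact Unitary.mul_star_self_of_mem hA.eigenvectorUnitary.2
  · exact Unitary.star_mul_self_of_mem hA.eigenvectorUnitary.2
  · conv_lhs => rw [hA.spectral_theorem]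
    rfl

namespace Diagonalizes

variable {A B U V : Matrix κ κ ℂ} {d e : κ → ℝ}

theorem conj (h : Diagonalizes A U d) : Uᴴ * A * U = diagonal (fun i => (d i : ℂ)) := by
  obtain ⟨-, h2, rfl⟩ := h
  calc _ = (Uᴴ * U) * diagonal (fun i => (d i : ℂ)) * (Uᴴ * U) := by simp only [Matrix.mul_assoc]
    _ = _ := by simp [h2]

theorem nonneg (h : Diagonalizes A U d) (hA : A.PosSemidef) (i : κ) : 0 ≤ d i := by
  have := hA.conjTranspose_mul_mul_same U
  rw [h.conj, posSemidef_diagonal_iff] at this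
  exact_mod_cast this i

theorem isHermitian (h : Diagonalizes A U d) : A.IsHermitian := by
  obtain ⟨-, -, rfl⟩ := h
  have : (diagonal fun i => (d i : ℂ)).IsHermitian := by
    rw [isHermitian_diagonal_iff]
    intro i
    simp [isSelfAdjoint_iff]
  exact isHermitian_mul_mul_conjTranspose U this

theorem aeval (h : Diagonalizes A U d) (p : Polynomial ℝ) :
    Polynomial.aeval A p = U * diagonal (fun i => ((p.eval (d i) : ℝ) : ℂ)) * Uᴴ := by
  induction p using Polynomial.induction_on' with
  | add p q hp hq =>
    rw [map_add, hp, hq, ← Matrix.add_mul, ← Matrix.mul_add, diagonal_add]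
    simp
  | monomial n a =>
    have hpow : ∀ n : ℕ, A ^ n = U * diagonal (fun i => ((d i ^ n : ℝ) : ℂ)) * Uᴴ := by
      intro n
      induction n with
      | zero => simp [h.1]
      | succ n ih =>
        rw [pow_succ, ih]
        conv_lhs => rw [h.2.2]
        calc _ = U * diagonal (fun i => ((d i ^ n : ℝ) : ℂ)) * (Uᴴ * U)
              * diagonal (fun i => (d i : ℂ)) * Uᴴ := by simp only [Matrix.mul_assoc]
          _ = _ := by
            rw [h.2.1, Matrix.mul_one, Matrix.mul_assoc U, diagonal_mul_diagonal]
            simp [pow_succ]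
    rw [Polynomial.aeval_monomial, hpow, ← Algebra.smul_def, ← Matrix.smul_mul,
      ← Matrix.mul_smul]
    congr 2
    ext i j
    by_cases hij : i = j
    · subst hij; simp
    · simp [hij]

/-- The functional calculus can be computed in any orthonormal eigenbasis. On the finitely many
eigenvalues the function agrees with a polynomial. -/
theorem cfc_eq (h : Diagonalizes A U d) (f : ℝ → ℝ) :
    cfc f A = U * diagonal (fun i => (f (d i) : ℂ)) * Uᴴ := by
  classical
  have hA := h.isHermitian
  set s : Finset ℝ := Finset.univ.image d ∪ Finset.univ.image hA.eigenvalues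
  set p : Polynomial ℝ := Lagrange.interpolate s id f
  have hp : ∀ x ∈ s, p.eval x = f x := fun x hx =>
    Lagrange.eval_interpolate_at_node (v := id) f (injOn_id _) hx
  have h1 : cfc f A = cfc p.eval A := by
    refine cfc_congr fun x hx => (hp x ?_).symm
    rw [hA.spectrum_real_eq_range_eigenvalues] at hx
    obtain ⟨i, rfl⟩ := hx
    simp [s]
  have h2 : cfc p.eval A = Polynomial.aeval A p :=
    cfc_polynomial (R := ℝ) (p := IsSelfAdjoint) p A hA
  rw [h1, h2, h.aeval]
  congr 3
  ext i
  rw [hp _ (by simp [s])]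

theorem psdPow_eq (h : Diagonalizes A U d) (s : ℝ) :
    Diagonalizes (psdPow A s) U (fun i => if d i = 0 then 0 else d i ^ s) :=
  ⟨h.1, h.2.1, h.cfc_eq _⟩

theorem kronecker {A' U' : Matrix κ' κ' ℂ} {d' : κ' → ℝ}
    (h : Diagonalizes A U d) (h' : Diagonalizes A' U' d') :
    Diagonalizes (A ⊗ₖ A') (U ⊗ₖ U') (fun p => d p.1 * d' p.2) := by
  refine ⟨?_, ?_, ?_⟩
  · rw [conjTranspose_kronecker, ← mul_kronecker_mul, h.1, h'.1, one_kronecker_one]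
  · rw [conjTranspose_kronecker, ← mul_kronecker_mul, h.2.1, h'.2.1, one_kronecker_one]
  · rw [h.2.2, h'.2.2, mul_kronecker_mul, mul_kronecker_mul, conjTranspose_kronecker,
      diagonal_kronecker_diagonal]
    simp

theorem reindex (h : Diagonalizes A U d) (σ : κ ≃ κ') :
    Diagonalizes (Matrix.reindex σ σ A) (Matrix.reindex σ σ U) (d ∘ σ.symm) := by
  refine ⟨?_, ?_, ?_⟩
  · simp [conjTranspose_submatrix, submatrix_mul_equiv, h.1]
  · simp [conjTranspose_submatrix, submatrix_mul_equiv, h.2.1]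
  · rw [h.2.2]
    simp only [reindex_apply, conjTranspose_submatrix, ← submatrix_mul_equiv _ _ _ σ.symm]
    congr 2
    ext i j
    by_cases hij : i = j
    · subst hij; simp
    · simp [hij]

/-- The trace of a product, in eigenbases of the two factors. -/
theorem trace_mul (hA : Diagonalizes A U d) (hB : Diagonalizes B V e) :
    (A * B).trace = ((∑ i, ∑ j, d i * e j * ‖(Uᴴ * V) i j‖ ^ 2 : ℝ) : ℂ) := by
  rw [hA.2.2, hB.2.2]
  calc _ = (diagonal (fun i => (d i : ℂ)) * (Uᴴ * V) * diagonal (fun i => (e i : ℂ))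
        * (Uᴴ * V)ᴴ).trace := by
        rw [Matrix.mul_assoc U, Matrix.mul_assoc U, Matrix.trace_mul_comm U]
        simp only [conjTranspose_mul, conjTranspose_conjTranspose, Matrix.mul_assoc]
    _ = _ := by
        simp only [trace, diag_apply, Matrix.mul_apply (N := (Uᴴ * V)ᴴ), mul_diagonal,
          diagonal_mul, conjTranspose_apply]
        push_cast
        refine Finset.sum_congr rfl fun i _ => Finset.sum_congr rfl fun j _ => ?_
        rw [← Complex.mul_conj']
        simp only [RCLike.star_def]
        ring

end Diagonalizes

/-- The scalar `x ^ α * y ^ (1 - α)` for `x, y ≥ 0`, with powers taken on the support. -/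
noncomputable def wgm (α x y : ℝ) : ℝ :=
  (if x = 0 then 0 else x ^ α) * (if y = 0 then 0 else y ^ (1 - α))

/-- `tr[A ^ α B ^ (1 - α)]` as a real number. -/
noncomputable def realQ (α : ℝ) (A B : Matrix κ κ ℂ) : ℝ := (psdPow A α * psdPow B (1 - α)).trace.re

theorem stateQ_eq (α : ℝ) (A B : Matrix κ κ ℂ) : stateQ α A B = ENNReal.ofReal (realQ α A B) := rfl

theorem realQ_eq {A B U V : Matrix κ κ ℂ} {d e : κ → ℝ} (hA : Diagonalizes A U d)
    (hB : Diagonalizes B V e) (α : ℝ) :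
    realQ α A B = ∑ i, ∑ j, wgm α (d i) (e j) * ‖(Uᴴ * V) i j‖ ^ 2 := by
  rw [realQ, (hA.psdPow_eq α).trace_mul (hB.psdPow_eq (1 - α)), Complex.ofReal_re]
  rfl

theorem wgm_nonneg {x y : ℝ} (hx : 0 ≤ x) (hy : 0 ≤ y) (α : ℝ) : 0 ≤ wgm α x y := by
  unfold wgm
  split_ifs <;> positivity

theorem wgm_eq_zero_iff {x y : ℝ} (hx : 0 ≤ x) (hy : 0 ≤ y) (α : ℝ) :
    wgm α x y = 0 ↔ x = 0 ∨ y = 0 := by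
  unfold wgm
  by_cases h : x = 0
  · simp [h]
  by_cases h' : y = 0
  · simp [h']
  simp [h, h', Real.rpow_eq_zero_iff_of_nonneg, hx, hy]

/-- The weighted inequality of the arithmetic and geometric means, also at the endpoints
`α = 0, 1`, where the powers on the support may be smaller than `Real.rpow`. -/
theorem wgm_le {x y α : ℝ} (hx : 0 ≤ x) (hy : 0 ≤ y) (hα : α ∈ Icc (0 : ℝ) 1) :
    wgm α x y ≤ α * x + (1 - α) * y := by
  have h0 : 0 ≤ α * x + (1 - α) * y := by
    have := hα.1; have := sub_nonneg.2 hα.2; positivity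
  unfold wgm
  by_cases h : x = 0
  · rw [if_pos h, zero_mul]; exact h0
  by_cases h' : y = 0
  · rw [if_pos h', mul_zero]; exact h0
  simpa [h, h'] using
    Real.geom_mean_le_arith_mean2_weighted hα.1 (sub_nonneg.2 hα.2) hx hy (by ring)

theorem wgm_eq_exp {x y : ℝ} (hx : 0 < x) (hy : 0 < y) :
    (fun α => wgm α x y) = fun α => Real.exp (Real.log x * α + Real.log y * (1 - α)) := by
  ext α
  rw [wgm, if_neg hx.ne', if_neg hy.ne', Real.exp_add, ← Real.rpow_def_of_pos hx,
    ← Real.rpow_def_of_pos hy]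

theorem continuous_wgm {x y : ℝ} (hx : 0 ≤ x) (hy : 0 ≤ y) : Continuous fun α => wgm α x y := by
  rcases hx.eq_or_lt with rfl | hx
  · simpa [wgm] using continuous_const
  rcases hy.eq_or_lt with rfl | hy
  · simpa [wgm] using continuous_const
  rw [wgm_eq_exp hx hy]
  fun_prop

theorem convexOn_wgm {x y : ℝ} (hx : 0 ≤ x) (hy : 0 ≤ y) :
    ConvexOn ℝ univ fun α => wgm α x y := by
  rcases hx.eq_or_lt with rfl | hx
  · simpa [wgm] using convexOn_const (0 : ℝ) convex_univ
  rcases hy.eq_or_lt with rfl | hy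
  · simpa [wgm] using convexOn_const (0 : ℝ) convex_univ
  rw [wgm_eq_exp hx hy]
  refine ⟨convex_univ, fun s _ t _ a b ha hb hab => ?_⟩
  have := convexOn_exp.2 (mem_univ (Real.log x * s + Real.log y * (1 - s)))
    (mem_univ (Real.log x * t + Real.log y * (1 - t))) ha hb hab
  refine le_trans (le_of_eq ?_) this
  dsimp only
  congr 1
  simp only [smul_eq_mul]
  linear_combination (-Real.log y) * hab

section realQ

variable {A B : Matrix κ κ ℂ}

theorem realQ_nonneg (hA : A.PosSemidef) (hB : B.PosSemidef) (α : ℝ) : 0 ≤ realQ α A B := by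
  obtain ⟨U, d, h⟩ := exists_diagonalizes hA.isHermitian
  obtain ⟨V, e, h'⟩ := exists_diagonalizes hB.isHermitian
  rw [realQ_eq h h']
  exact Finset.sum_nonneg fun i _ => Finset.sum_nonneg fun j _ =>
    mul_nonneg (wgm_nonneg (h.nonneg hA i) (h'.nonneg hB j) α) (by positivity)

theorem continuous_realQ (hA : A.PosSemidef) (hB : B.PosSemidef) :
    Continuous fun α => realQ α A B := by
  obtain ⟨U, d, h⟩ := exists_diagonalizes hA.isHermitian
  obtain ⟨V, e, h'⟩ := exists_diagonalizes hB.isHermitian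
  simp_rw [realQ_eq h h']
  exact continuous_finsetSum _ fun i _ => continuous_finsetSum _ fun j _ =>
    (continuous_wgm (h.nonneg hA i) (h'.nonneg hB j)).mul continuous_const

theorem convexOn_realQ (hA : A.PosSemidef) (hB : B.PosSemidef) :
    ConvexOn ℝ univ fun α => realQ α A B := by
  obtain ⟨U, d, h⟩ := exists_diagonalizes hA.isHermitian
  obtain ⟨V, e, h'⟩ := exists_diagonalizes hB.isHermitian
  refine ⟨convex_univ, fun s _ t _ a b ha hb hab => ?_⟩
  simp only [realQ_eq h h', smul_eq_mul, Finset.mul_sum, ← Finset.sum_add_distrib]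
  refine Finset.sum_le_sum fun i _ => Finset.sum_le_sum fun j _ => ?_
  have := (convexOn_wgm (h.nonneg hA i) (h'.nonneg hB j)).2 (mem_univ s) (mem_univ t) ha hb hab
  simp only [smul_eq_mul] at this
  rw [← mul_assoc, ← mul_assoc, ← add_mul]
  gcongr

/-- Whether the quasi-divergence vanishes does not depend on `α`: in eigenbases it is a sum of
nonnegative terms, each of which vanishes for one `α` exactly if it does for all. -/
theorem realQ_eq_zero (hA : A.PosSemidef) (hB : B.PosSemidef) {α : ℝ} (h0 : realQ α A B = 0)
    (β : ℝ) : realQ β A B = 0 := by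
  obtain ⟨U, d, h⟩ := exists_diagonalizes hA.isHermitian
  obtain ⟨V, e, h'⟩ := exists_diagonalizes hB.isHermitian
  have hn : ∀ i j, 0 ≤ wgm α (d i) (e j) * ‖(Uᴴ * V) i j‖ ^ 2 := fun i j =>
    mul_nonneg (wgm_nonneg (h.nonneg hA i) (h'.nonneg hB j) α) (by positivity)
  rw [realQ_eq h h'] at h0 ⊢
  rw [Finset.sum_eq_zero_iff_of_nonneg fun i _ => Finset.sum_nonneg fun j _ => hn i j] at h0
  refine Finset.sum_eq_zero fun i hi => Finset.sum_eq_zero fun j hj => ?_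
  have := h0 i hi
  rw [Finset.sum_eq_zero_iff_of_nonneg fun j _ => hn i j] at this
  have := this j hj
  rwa [mul_eq_zero, wgm_eq_zero_iff (h.nonneg hA i) (h'.nonneg hB j)] at this ⊢

theorem realQ_le_one (hA : A ∈ density κ) (hB : B ∈ density κ) {α : ℝ} (hα : α ∈ Icc (0 : ℝ) 1) :
    realQ α A B ≤ 1 := by
  obtain ⟨U, d, h⟩ := exists_diagonalizes hA.1.isHermitian
  obtain ⟨V, e, h'⟩ := exists_diagonalizes hB.1.isHermitian
  have one_diag : ∀ W : Matrix κ κ ℂ, W * Wᴴ = 1 → Wᴴ * W = 1 → Diagonalizes 1 W 1 := by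
    intro W h1 h2
    refine ⟨h1, h2, ?_⟩
    simp [h1]
  have hA1 : ∑ i, ∑ j, d i * ‖(Uᴴ * V) i j‖ ^ 2 = 1 := by
    have := h.trace_mul (one_diag V h'.1 h'.2.1)
    rw [Matrix.mul_one, hA.2] at this
    have := this.symm
    simpa using (by exact_mod_cast this : ∑ i, ∑ j, d i * (1 : κ → ℝ) j * ‖(Uᴴ * V) i j‖ ^ 2 = 1)
  have hB1 : ∑ i, ∑ j, e j * ‖(Uᴴ * V) i j‖ ^ 2 = 1 := by
    have := (one_diag U h.1 h.2.1).trace_mul h'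
    rw [Matrix.one_mul, hB.2] at this
    have := this.symm
    simpa using (by exact_mod_cast this : ∑ i, ∑ j, (1 : κ → ℝ) i * e j * ‖(Uᴴ * V) i j‖ ^ 2 = 1)
  rw [realQ_eq h h']
  calc _ ≤ ∑ i, ∑ j, (α * d i + (1 - α) * e j) * ‖(Uᴴ * V) i j‖ ^ 2 := by
        refine Finset.sum_le_sum fun i _ => Finset.sum_le_sum fun j _ => ?_
        gcongr
        exact wgm_le (h.nonneg hA.1 i) (h'.nonneg hB.1 j) hα
    _ = α * (∑ i, ∑ j, d i * ‖(Uᴴ * V) i j‖ ^ 2)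
        + (1 - α) * ∑ i, ∑ j, e j * ‖(Uᴴ * V) i j‖ ^ 2 := by
        simp only [Finset.mul_sum, ← Finset.sum_add_distrib]
        refine Finset.sum_congr rfl fun i _ => Finset.sum_congr rfl fun j _ => ?_
        ring
    _ = 1 := by rw [hA1, hB1]; ring

end realQ

/-! ### Tensor products -/

section tensor

variable {ι : Type*} [Fintype ι] [DecidableEq ι] {n m : ℕ}

theorem psdPow_tensor {X : PowMat ι n} {Y : PowMat ι m} (hX : X.PosSemidef) (hY : Y.PosSemidef)
    (s : ℝ) : psdPow (tensor X Y) s = tensor (psdPow X s) (psdPow Y s) := by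
  obtain ⟨U, d, h⟩ := exists_diagonalizes hX.isHermitian
  obtain ⟨V, e, h'⟩ := exists_diagonalizes hY.isHermitian
  have h1 := ((h.kronecker h').reindex (Fin.appendEquiv n m)).psdPow_eq s
  have h2 := ((h.psdPow_eq s).kronecker (h'.psdPow_eq s)).reindex (Fin.appendEquiv n m)
  refine h1.2.2.trans (Eq.trans ?_ h2.2.2.symm)
  congr 3
  ext p
  simp only [Function.comp_apply, mul_eq_zero]
  have := h.nonneg hX ((Fin.appendEquiv n m).symm p).1
  have := h'.nonneg hY ((Fin.appendEquiv n m).symm p).2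
  split_ifs <;> simp_all [Real.mul_rpow]

theorem realQ_tensor {X X' : PowMat ι n} {Y Y' : PowMat ι m} (hX : X.PosSemidef)
    (hY : Y.PosSemidef) (hX' : X'.PosSemidef) (hY' : Y'.PosSemidef) (α : ℝ) :
    realQ α (tensor X Y) (tensor X' Y') = realQ α X X' * realQ α Y Y' := by
  have key : ∀ (P P' : PowMat ι n) (R R' : PowMat ι m),
      (tensor P R * tensor P' R').trace = (P * P').trace * (R * R').trace := by
    intro P P' R R'
    rw [tensor, tensor, reindex_apply, reindex_apply, submatrix_mul_equiv, ← mul_kronecker_mul,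
      ← trace_kronecker]
    exact Fintype.sum_equiv (Fin.appendEquiv n m).symm _ _ fun _ => rfl
  obtain ⟨U, d, h⟩ := exists_diagonalizes hX.isHermitian
  obtain ⟨U', d', h'⟩ := exists_diagonalizes hX'.isHermitian
  rw [realQ, psdPow_tensor hX hY, psdPow_tensor hX' hY', key,
    (h.psdPow_eq α).trace_mul (h'.psdPow_eq (1 - α)), Complex.re_ofReal_mul, realQ,
    (h.psdPow_eq α).trace_mul (h'.psdPow_eq (1 - α)), Complex.ofReal_re, realQ]

end tensor

end QChernoff

/-! ### Joint concavity -/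

namespace QChernoff

open Matrix MeasureTheory

variable {κ : Type*} [Fintype κ] [DecidableEq κ]

/-- Minimizing `t⁻¹ x |w - z|² + y |z|²` over `z` gives `x y / (x + t y) |w|²`: the lower bound. -/
theorem harmonic_mul_sq_le {t x y : ℝ} (ht : 0 < t) (hx : 0 ≤ x) (hy : 0 ≤ y) (w z : ℂ) :
    x * y / (x + t * y) * ‖w‖ ^ 2 ≤ t⁻¹ * (x * ‖w - z‖ ^ 2) + y * ‖z‖ ^ 2 := by
  have hR : 0 ≤ t⁻¹ * (x * ‖w - z‖ ^ 2) + y * ‖z‖ ^ 2 := by positivity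
  rcases (show 0 ≤ x + t * y by positivity).eq_or_lt with h | h
  · rwa [← h, div_zero, zero_mul]
  have htri : ‖w‖ ≤ ‖w - z‖ + ‖z‖ := by simpa using norm_add_le (w - z) z
  generalize ‖w - z‖ = p at *
  generalize ‖z‖ = q at *
  calc x * y / (x + t * y) * ‖w‖ ^ 2 ≤ x * y / (x + t * y) * (p + q) ^ 2 := by gcongr
    _ ≤ _ := by
      rw [div_mul_eq_mul_div, div_le_iff₀ h]
      have : (t⁻¹ * (x * p ^ 2) + y * q ^ 2) * (x + t * y) - x * y * (p + q) ^ 2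
          = t⁻¹ * (x * p - t * y * q) ^ 2 := by
        field_simp
        ring
      have h2 : 0 ≤ t⁻¹ * (x * p - t * y * q) ^ 2 := by positivity
      linarith

/-- The lower bound of `harmonic_mul_sq_le` is attained, also where `x + t y = 0`. -/
theorem exists_harmonic_mul_sq_eq {t x y : ℝ} (ht : 0 < t) (hx : 0 ≤ x) (hy : 0 ≤ y) (w : ℂ) :
    ∃ z : ℂ, t⁻¹ * (x * ‖w - z‖ ^ 2) + y * ‖z‖ ^ 2 = x * y / (x + t * y) * ‖w‖ ^ 2 := by
  rcases (show 0 ≤ x + t * y by positivity).eq_or_lt with h | h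
  · have h1 : x = 0 := by nlinarith [mul_nonneg ht.le hy]
    have h2 : y = 0 := by
      subst h1
      simpa [ht.ne'] using h.symm
    exact ⟨0, by simp [h1, h2]⟩
  · refine ⟨((x / (x + t * y) : ℝ) : ℂ) * w, ?_⟩
    have h1 : w - ((x / (x + t * y) : ℝ) : ℂ) * w = ((t * y / (x + t * y) : ℝ) : ℂ) * w := by
      have : ((t * y / (x + t * y) : ℝ) : ℂ) = 1 - ((x / (x + t * y) : ℝ) : ℂ) := by
        rw [← Complex.ofReal_one, ← Complex.ofReal_sub]
        congr 1
        field_simp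
        ring
      rw [this]
      ring
    rw [h1, norm_mul, norm_mul, Complex.norm_real, Complex.norm_real, mul_pow, mul_pow,
      Real.norm_eq_abs, Real.norm_eq_abs, sq_abs, sq_abs]
    field_simp
    ring

/-- A quadratic functional of the splitting `1 = (1 - X) + X`, affine in `(A, B)`. Its minimum over
`X` is the trace of a parallel sum of left multiplication by `A` and right multiplication by
`B`. -/
noncomputable def splitCost (t : ℝ) (A B X : Matrix κ κ ℂ) : ℝ :=
  t⁻¹ * ((1 - X)ᴴ * A * (1 - X)).trace.re + (X * B * Xᴴ).trace.re

theorem splitCost_add_smul (t a b : ℝ) (A B A' B' X : Matrix κ κ ℂ) :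
    splitCost t (a • A + b • A') (a • B + b • B') X
      = a * splitCost t A B X + b * splitCost t A' B' X := by
  simp only [splitCost, Matrix.mul_add, Matrix.add_mul, Matrix.mul_smul, Matrix.smul_mul,
    trace_add, trace_smul, Complex.add_re, Complex.smul_re, smul_eq_mul]
  ring

theorem re_trace_mul_diagonal_mul_conjTranspose (Y : Matrix κ κ ℂ) (e : κ → ℝ) :
    (Y * diagonal (fun i => (e i : ℂ)) * Yᴴ).trace.re = ∑ i, ∑ j, e j * ‖Y i j‖ ^ 2 := by
  rw [← Complex.ofReal_re (∑ i, ∑ j, e j * ‖Y i j‖ ^ 2)]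
  congr 1
  simp only [trace, diag_apply, Matrix.mul_apply (N := Yᴴ), mul_diagonal, conjTranspose_apply]
  push_cast
  refine Finset.sum_congr rfl fun i _ => Finset.sum_congr rfl fun j _ => ?_
  rw [← Complex.mul_conj']
  simp only [RCLike.star_def]
  ring

section eigenbases

variable {A B U V : Matrix κ κ ℂ} {d e : κ → ℝ}

theorem splitCost_eq (hA : Diagonalizes A U d) (hB : Diagonalizes B V e) (t : ℝ)
    (X : Matrix κ κ ℂ) :
    splitCost t A B X = ∑ i, ∑ j, (t⁻¹ * (d i * ‖(Uᴴ * V) i j - (Uᴴ * X * V) i j‖ ^ 2)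
      + e j * ‖(Uᴴ * X * V) i j‖ ^ 2) := by
  have h1 : ∀ Z : Matrix κ κ ℂ,
      (Zᴴ * A * Z).trace.re = ∑ i, ∑ j, d i * ‖(Uᴴ * Z * V) i j‖ ^ 2 := by
    intro Z
    have : (Zᴴ * A * Z).trace
        = ((Uᴴ * Z * V)ᴴ * diagonal (fun i => (d i : ℂ)) * (Uᴴ * Z * V)ᴴᴴ).trace := by
      conv_rhs => rw [← hA.conj, conjTranspose_conjTranspose, conjTranspose_mul,
        conjTranspose_mul, conjTranspose_conjTranspose]
      calc _ = ((V * Vᴴ) * (Zᴴ * A * Z)).trace := by rw [hB.1, Matrix.one_mul]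
        _ = ((Vᴴ * (Zᴴ * ((U * Uᴴ) * A * (U * Uᴴ)) * Z)) * V).trace := by
          rw [hA.1, Matrix.one_mul, Matrix.mul_one, Matrix.mul_assoc V, Matrix.trace_mul_comm V]
        _ = _ := by simp only [Matrix.mul_assoc]
    rw [this, re_trace_mul_diagonal_mul_conjTranspose, Finset.sum_comm]
    simp [conjTranspose_apply]
  have h2 : (X * B * Xᴴ).trace.re = ∑ i, ∑ j, e j * ‖(Uᴴ * X * V) i j‖ ^ 2 := by
    rw [← re_trace_mul_diagonal_mul_conjTranspose]
    congr 1
    calc _ = ((U * Uᴴ) * (X * B * Xᴴ)).trace := by rw [hA.1, Matrix.one_mul]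
      _ = ((Uᴴ * (X * B * Xᴴ)) * U).trace := by rw [Matrix.mul_assoc U, Matrix.trace_mul_comm U]
      _ = _ := by
        conv_lhs => rw [hB.2.2]
        simp only [conjTranspose_mul, conjTranspose_conjTranspose, Matrix.mul_assoc]
  rw [splitCost, h1, h2, Finset.mul_sum, ← Finset.sum_add_distrib]
  refine Finset.sum_congr rfl fun i _ => ?_
  rw [Finset.mul_sum, ← Finset.sum_add_distrib]
  refine Finset.sum_congr rfl fun j _ => ?_
  rw [Matrix.mul_sub, Matrix.sub_mul, Matrix.mul_one, Matrix.sub_apply]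

/-- In eigenbases the minimization of `splitCost` decouples into scalar ones. -/
theorem sum_harmonic_le_splitCost (hA : Diagonalizes A U d) (hB : Diagonalizes B V e)
    (hA' : A.PosSemidef) (hB' : B.PosSemidef) {t : ℝ} (ht : 0 < t) (X : Matrix κ κ ℂ) :
    ∑ i, ∑ j, d i * e j / (d i + t * e j) * ‖(Uᴴ * V) i j‖ ^ 2 ≤ splitCost t A B X := by
  rw [splitCost_eq hA hB]
  exact Finset.sum_le_sum fun i _ => Finset.sum_le_sum fun j _ =>
    harmonic_mul_sq_le ht (hA.nonneg hA' i) (hB.nonneg hB' j) _ _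

theorem exists_splitCost_eq (hA : Diagonalizes A U d) (hB : Diagonalizes B V e)
    (hA' : A.PosSemidef) (hB' : B.PosSemidef) {t : ℝ} (ht : 0 < t) :
    ∃ X, splitCost t A B X
      = ∑ i, ∑ j, d i * e j / (d i + t * e j) * ‖(Uᴴ * V) i j‖ ^ 2 := by
  choose z hz using fun i j =>
    exists_harmonic_mul_sq_eq ht (hA.nonneg hA' i) (hB.nonneg hB' j) ((Uᴴ * V) i j)
  refine ⟨U * Matrix.of z * Vᴴ, ?_⟩
  have : Uᴴ * (U * Matrix.of z * Vᴴ) * V = Matrix.of z := by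
    calc _ = (Uᴴ * U) * Matrix.of z * (Vᴴ * V) := by simp only [Matrix.mul_assoc]
      _ = _ := by rw [hA.2.1, hB.2.1, Matrix.one_mul, Matrix.mul_one]
  rw [splitCost_eq hA hB, this]
  exact Finset.sum_congr rfl fun i _ => Finset.sum_congr rfl fun j _ => hz i j

end eigenbases

/-- The perspective of the integrand in the integral representation of the power function. -/
theorem wgm_integrand {α t x y : ℝ} (hα : α ∈ Ioo (0 : ℝ) 1) (ht : 0 < t) (hx : 0 ≤ x)
    (hy : 0 ≤ y) :
    y * Real.rpowIntegrand₀₁ α t (x / y) = t ^ (α - 1) * (x * y / (x + t * y)) := by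
  rcases hy.eq_or_lt with rfl | hy
  · simp
  rw [Real.rpowIntegrand₀₁_eq_pow_div hα ht.le (by positivity)]
  field_simp
  ring

theorem integrableOn_wgm {α x y : ℝ} (hα : α ∈ Ioo (0 : ℝ) 1) (hx : 0 ≤ x) (hy : 0 ≤ y) :
    IntegrableOn (fun t => t ^ (α - 1) * (x * y / (x + t * y))) (Ioi 0) := by
  have h : IntegrableOn (fun t => y * Real.rpowIntegrand₀₁ α t (x / y)) (Ioi 0) :=
    (Real.integrableOn_rpowIntegrand₀₁_Ioi hα (div_nonneg hx hy)).const_mul y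
  exact h.congr_fun (fun t ht => wgm_integrand hα ht hx hy) measurableSet_Ioi

theorem wgm_eq_integral {α x y : ℝ} (hα : α ∈ Ioo (0 : ℝ) 1) (hx : 0 ≤ x) (hy : 0 ≤ y) :
    wgm α x y = (∫ t in Ioi 0, Real.rpowIntegrand₀₁ α t 1)⁻¹
      * ∫ t in Ioi 0, t ^ (α - 1) * (x * y / (x + t * y)) := by
  have h : ∫ t in Ioi 0, t ^ (α - 1) * (x * y / (x + t * y))
      = y * ∫ t in Ioi 0, Real.rpowIntegrand₀₁ α t (x / y) := by
    rw [← integral_const_mul]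
    exact setIntegral_congr_fun measurableSet_Ioi fun t ht => (wgm_integrand hα ht hx hy).symm
  rw [h, mul_left_comm, ← Real.rpow_eq_const_mul_integral hα (div_nonneg hx hy), wgm]
  rcases hx.eq_or_lt with rfl | hx
  · simp [Real.zero_rpow hα.1.ne']
  rcases hy.eq_or_lt with rfl | hy
  · simp
  rw [if_neg hx.ne', if_neg hy.ne', Real.div_rpow hx.le hy.le, Real.rpow_sub hy, Real.rpow_one]
  ring

section integral

variable {A B U V : Matrix κ κ ℂ} {d e : κ → ℝ} {α : ℝ}

theorem integrableOn_sum_harmonic (hA : Diagonalizes A U d) (hB : Diagonalizes B V e)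
    (hA' : A.PosSemidef) (hB' : B.PosSemidef) (hα : α ∈ Ioo (0 : ℝ) 1) :
    IntegrableOn (fun t => t ^ (α - 1) *
      ∑ i, ∑ j, d i * e j / (d i + t * e j) * ‖(Uᴴ * V) i j‖ ^ 2) (Ioi 0) := by
  simp only [Finset.mul_sum, ← mul_assoc (_ ^ (α - 1))]
  exact integrable_finsetSum _ fun i _ => integrable_finsetSum _ fun j _ =>
    (integrableOn_wgm hα (hA.nonneg hA' i) (hB.nonneg hB' j)).mul_const _

theorem realQ_eq_integral (hA : Diagonalizes A U d) (hB : Diagonalizes B V e)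
    (hA' : A.PosSemidef) (hB' : B.PosSemidef) (hα : α ∈ Ioo (0 : ℝ) 1) :
    realQ α A B = (∫ t in Ioi 0, Real.rpowIntegrand₀₁ α t 1)⁻¹
      * ∫ t in Ioi 0, t ^ (α - 1) *
        ∑ i, ∑ j, d i * e j / (d i + t * e j) * ‖(Uᴴ * V) i j‖ ^ 2 := by
  have hint := fun i j => (integrableOn_wgm hα (hA.nonneg hA' i) (hB.nonneg hB' j)).mul_const
    (‖(Uᴴ * V) i j‖ ^ 2)
  simp only [Finset.mul_sum, ← mul_assoc (_ ^ (α - 1))]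
  rw [integral_finsetSum _ fun i _ => integrable_finsetSum _ fun j _ => hint i j, realQ_eq hA hB,
    Finset.mul_sum]
  refine Finset.sum_congr rfl fun i _ => ?_
  rw [integral_finsetSum _ fun j _ => hint i j, Finset.mul_sum]
  refine Finset.sum_congr rfl fun j _ => ?_
  rw [integral_mul_const, wgm_eq_integral hα (hA.nonneg hA' i) (hB.nonneg hB' j), mul_assoc]

end integral

/-- **Lieb's concavity theorem** for `tr[A ^ α B ^ (1 - α)]`. For `0 < α < 1` this is a positive
combination of minima of affine functionals; the endpoints follow by continuity in `α`. -/
theorem le_realQ_add_smul {A B A' B' : Matrix κ κ ℂ} (hA : A.PosSemidef) (hB : B.PosSemidef)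
    (hA' : A'.PosSemidef) (hB' : B'.PosSemidef) {a b : ℝ} (ha : 0 ≤ a) (hb : 0 ≤ b) {α : ℝ}
    (hα : α ∈ Icc (0 : ℝ) 1) :
    a * realQ α A B + b * realQ α A' B' ≤ realQ α (a • A + b • A') (a • B + b • B') := by
  have hA'' : (a • A + b • A').PosSemidef := (hA.smul ha).add (hA'.smul hb)
  have hB'' : (a • B + b • B').PosSemidef := (hB.smul ha).add (hB'.smul hb)
  have key : ∀ α ∈ Ioo (0 : ℝ) 1,
      a * realQ α A B + b * realQ α A' B' ≤ realQ α (a • A + b • A') (a • B + b • B') := by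
    intro α hα
    obtain ⟨U, d, hU⟩ := exists_diagonalizes hA.isHermitian
    obtain ⟨V, e, hV⟩ := exists_diagonalizes hB.isHermitian
    obtain ⟨U', d', hU'⟩ := exists_diagonalizes hA'.isHermitian
    obtain ⟨V', e', hV'⟩ := exists_diagonalizes hB'.isHermitian
    obtain ⟨U'', d'', hU''⟩ := exists_diagonalizes hA''.isHermitian
    obtain ⟨V'', e'', hV''⟩ := exists_diagonalizes hB''.isHermitian
    rw [realQ_eq_integral hU hV hA hB hα, realQ_eq_integral hU' hV' hA' hB' hα,
      realQ_eq_integral hU'' hV'' hA'' hB'' hα, mul_left_comm a, mul_left_comm b, ← mul_add,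
      ← integral_const_mul, ← integral_const_mul]
    have i1 := (integrableOn_sum_harmonic hU hV hA hB hα).const_mul a
    have i2 := (integrableOn_sum_harmonic hU' hV' hA' hB' hα).const_mul b
    rw [← integral_add i1 i2]
    refine mul_le_mul_of_nonneg_left ?_
      (inv_nonneg.2 (Real.integral_rpowIntegrand₀₁_one_pos hα).le)
    refine setIntegral_mono_on (i1.add i2) (integrableOn_sum_harmonic hU'' hV'' hA'' hB'' hα)
      measurableSet_Ioi fun t ht => ?_
    obtain ⟨X, hX⟩ := exists_splitCost_eq hU'' hV'' hA'' hB'' ht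
    rw [← hX, splitCost_add_smul, mul_left_comm a, mul_left_comm b, ← mul_add]
    have ht' : 0 ≤ t ^ (α - 1) := Real.rpow_nonneg (le_of_lt ht) _
    gcongr
    · exact sum_harmonic_le_splitCost hU hV hA hB ht X
    · exact sum_harmonic_le_splitCost hU' hV' hA' hB' ht X
  rw [← closure_Ioo (zero_ne_one' ℝ)] at hα
  exact le_on_closure key
    ((continuous_const.mul (continuous_realQ hA hB)).add
      (continuous_const.mul (continuous_realQ hA' hB'))).continuousOn
    (continuous_realQ hA'' hB'').continuousOn hα

end QChernoff

/-! ### A minimax theorem -/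

namespace QChernoff

/-- A minimax theorem in which the second variable ranges over a convex set without topology.
A failure of the conclusion is witnessed by finitely many points of `C`, by compactness of `[0, 1]`;
on the simplex of their convex combinations Sion's theorem applies. -/
theorem exists_forall_le_of_convexOn_concaveOn {E : Type*} [AddCommGroup E] [Module ℝ E]
    {C : Set E} (hC : Convex ℝ C) {f : ℝ → E → ℝ}
    (hcont : ∀ p ∈ C, ContinuousOn (f · p) (Icc 0 1))
    (hconv : ∀ p ∈ C, ConvexOn ℝ (Icc 0 1) (f · p))
    (hconc : ∀ α ∈ Icc (0 : ℝ) 1, ConcaveOn ℝ C (f α)) {v : ℝ}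
    (h : ∀ p ∈ C, ∃ α ∈ Icc (0 : ℝ) 1, f α p ≤ v) :
    ∃ α ∈ Icc (0 : ℝ) 1, ∀ p ∈ C, f α p ≤ v := by
  by_contra! H
  obtain ⟨u, hu⟩ := (LowerSemicontinuousOn.inter_biInter_preimage_Iic_eq_empty_iff_exists_finset
    (isCompact_Icc (a := (0 : ℝ)) (b := 1)) (I := C) (f := fun p α => f α p) (c := v)
    fun p hp => (hcont p hp).lowerSemicontinuousOn).1 (by
      rw [eq_empty_iff_forall_notMem]
      rintro α ⟨hα, hα'⟩
      obtain ⟨p, hp, hlt⟩ := H α hα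
      have : f α p ≤ v := by simpa using mem_iInter₂.1 hα' p hp
      exact absurd this (not_le.2 hlt))
  classical
  obtain ⟨w, hw, hlt⟩ := Sion.exists_lt_iInf_of_lt_iInf_of_finite
    (X := Icc (0 : ℝ) 1) (Y := stdSimplex ℝ u) (f := fun α w => ∑ i, w i * f α i.1.1)
    (nonempty_Icc.2 zero_le_one) isCompact_Icc
    (fun w _ => (continuousOn_finsetSum _ fun i _ =>
      continuousOn_const.mul (hcont _ i.1.2)).lowerSemicontinuousOn)
    (fun w hw => ConvexOn.quasiconvexOn ⟨convex_Icc 0 1, fun x hx y hy a b ha hb hab => by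
      simp only [smul_eq_mul, Finset.mul_sum, ← Finset.sum_add_distrib]
      refine Finset.sum_le_sum fun i _ => ?_
      have := (hconv _ i.1.2).2 hx hy ha hb hab
      simp only [smul_eq_mul] at this
      rw [mul_left_comm a, mul_left_comm b, ← mul_add]
      exact mul_le_mul_of_nonneg_left this (hw.1 i)⟩)
    (convex_stdSimplex ℝ u)
    (fun α _ => Continuous.upperSemicontinuous (by fun_prop) |>.upperSemicontinuousOn _)
    (fun α _ => ConcaveOn.quasiconcaveOn ⟨convex_stdSimplex ℝ u, fun x _ y _ a b _ _ _ => by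
      simp only [smul_eq_mul, Finset.mul_sum, ← Finset.sum_add_distrib, Pi.add_apply,
        Pi.smul_apply]
      exact Finset.sum_le_sum fun i _ => le_of_eq (by ring)⟩)
    (convex_Icc 0 1) (s := range fun i : u => Pi.single i (1 : ℝ)) (finite_range _)
    (by rintro _ ⟨i, rfl⟩; exact single_mem_stdSimplex ℝ i) (t := v)
    (fun α hα => by
      obtain ⟨i, hi, hlt⟩ := hu α hα
      exact ⟨_, ⟨⟨i, hi⟩, rfl⟩, by simpa [Pi.single_apply] using hlt⟩)
  have hmem : ∑ i, w i • (i.1.1 : E) ∈ C :=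
    hC.sum_mem (fun i _ => hw.1 i) hw.2 fun i _ => i.1.2
  obtain ⟨α, hα, hle⟩ := h _ hmem
  have := (hconc α hα).le_map_sum (fun i _ => hw.1 i) hw.2 fun (i : u) _ => i.1.2
  simp only [smul_eq_mul] at this
  exact absurd ((hlt α hα).trans_le (this.trans hle)) (lt_irrefl _)

/-! ### The logarithm -/

section negLog2

theorem coe_log_two_pos : (0 : EReal) < ((Real.log 2 : ℝ) : EReal) :=
  EReal.coe_pos.2 (Real.log_pos one_lt_two)

theorem strictAnti_negLog2 : StrictAnti negLog2 := fun _ _ hxy =>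
  EReal.neg_lt_neg_iff.2 (EReal.strictMono_div_right_of_pos coe_log_two_pos (EReal.coe_ne_top _)
    (ENNReal.log_strictMono hxy))

theorem surjective_negLog2 : Function.Surjective negLog2 := by
  intro y
  obtain ⟨x, hx⟩ := ENNReal.log_surjective (-y * ((Real.log 2 : ℝ) : EReal))
  refine ⟨x, ?_⟩
  rw [negLog2, hx, ← EReal.mul_div_right, EReal.div_mul_cancel (EReal.coe_ne_bot _)
    (EReal.coe_ne_top _) coe_log_two_pos.ne', neg_neg]

/-- The function `-log₂` as an order-reversing bijection from `[0, ∞]` to the extended reals. -/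
noncomputable def negLog2Iso : ℝ≥0∞ ≃o ERealᵒᵈ :=
  StrictMono.orderIsoOfSurjective (fun x => OrderDual.toDual (negLog2 x))
    (fun _ _ h => strictAnti_negLog2 h) surjective_negLog2

theorem negLog2_eq (x : ℝ≥0∞) : negLog2 x = OrderDual.ofDual (negLog2Iso x) := rfl

theorem continuous_negLog2 : Continuous negLog2 :=
  continuous_ofDual.comp negLog2Iso.continuous

theorem negLog2_iSup {σ : Sort*} (f : σ → ℝ≥0∞) : negLog2 (⨆ i, f i) = ⨅ i, negLog2 (f i) := by
  rw [negLog2_eq, negLog2Iso.map_iSup]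
  rfl

theorem negLog2_limsup (f : ℕ → ℝ≥0∞) :
    negLog2 (limsup f atTop) = liminf (fun n => negLog2 (f n)) atTop := by
  rw [negLog2_eq, negLog2Iso.limsup_apply]
  rfl

theorem negLog2_zero : negLog2 0 = ⊤ := by
  rw [negLog2, ENNReal.log_zero, EReal.bot_div_of_pos_ne_top coe_log_two_pos (EReal.coe_ne_top _),
    EReal.neg_bot]

theorem negLog2_eq_top {x : ℝ≥0∞} : negLog2 x = ⊤ ↔ x = 0 := by
  rw [← negLog2_zero, strictAnti_negLog2.injective.eq_iff]

theorem negLog2_nonneg {x : ℝ≥0∞} (hx : x ≤ 1) : 0 ≤ negLog2 x := by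
  have h : negLog2 1 = 0 := by simp [negLog2]
  rw [← h]
  exact strictAnti_negLog2.antitone hx

theorem negLog2_mul {x y : ℝ≥0∞} (hx : x ≤ 1) (hy : y ≤ 1) :
    negLog2 (x * y) = negLog2 x + negLog2 y := by
  have hne : ∀ {z : ℝ≥0∞}, z ≤ 1 → ENNReal.log z / ((Real.log 2 : ℝ) : EReal) ≠ ⊤ := by
    intro z hz h
    have := negLog2_nonneg hz
    rw [negLog2, h] at this
    simp at this
  rw [negLog2, ENNReal.log_mul_add, EReal.add_div_of_nonneg_right coe_log_two_pos.le,
    EReal.neg_add (Or.inr (hne hy)) (Or.inl (hne hx)), sub_eq_add_neg]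
  rfl

theorem negLog2_rpow_one_div (x : ℝ≥0∞) (n : ℕ) :
    negLog2 (x ^ (1 / (n : ℝ))) = negLog2 x / (n : EReal) := by
  have h : ((1 / (n : ℝ) : ℝ) : EReal) = 1 / (n : EReal) := by
    rw [EReal.coe_div]; simp
  rw [negLog2, ENNReal.log_rpow, h, negLog2, EReal.div_eq_inv_mul, EReal.div_eq_inv_mul,
    EReal.div_eq_inv_mul, EReal.div_eq_inv_mul, mul_one, mul_left_comm, mul_neg]

end negLog2

/-! ### Divergences of convex sets -/

section sets

variable {κ : Type*} [Fintype κ] [DecidableEq κ] {C₁ C₂ : Set (Matrix κ κ ℂ)}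

theorem stateQ_le_one {A B : Matrix κ κ ℂ} (hA : A ∈ density κ) (hB : B ∈ density κ) {α : ℝ}
    (hα : α ∈ Icc (0 : ℝ) 1) : stateQ α A B ≤ 1 := by
  rw [stateQ_eq, ENNReal.ofReal_le_one]
  exact realQ_le_one hA hB hα

theorem setQ_le_one (h₁ : C₁ ⊆ density κ) (h₂ : C₂ ⊆ density κ) {α : ℝ}
    (hα : α ∈ Icc (0 : ℝ) 1) : setQ α C₁ C₂ ≤ 1 :=
  iSup₂_le fun _ hA => iSup₂_le fun _ hB => stateQ_le_one (h₁ hA) (h₂ hB) hα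

theorem continuous_stateQ {A B : Matrix κ κ ℂ} (hA : A ∈ density κ) (hB : B ∈ density κ) :
    Continuous fun α => stateQ α A B :=
  ENNReal.continuous_ofReal.comp (continuous_realQ hA.1 hB.1)

theorem negLog2_setQ (α : ℝ) :
    negLog2 (setQ α C₁ C₂) = ⨅ A ∈ C₁, ⨅ B ∈ C₂, negLog2 (stateQ α A B) := by
  simp only [setQ, negLog2_iSup]

theorem le_negLog2_setQ {c : EReal} {α : ℝ} :
    c ≤ negLog2 (setQ α C₁ C₂) ↔ ∀ A ∈ C₁, ∀ B ∈ C₂, c ≤ negLog2 (stateQ α A B) := by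
  simp only [negLog2_setQ, le_iInf_iff]

/-- As `-log₂ Q_α` is an infimum of functions continuous in `α`, it is upper semicontinuous. -/
theorem isClosed_le_negLog2_setQ (h₁ : C₁ ⊆ density κ) (h₂ : C₂ ⊆ density κ) (c : EReal) :
    IsClosed {α : ℝ | c ≤ negLog2 (setQ α C₁ C₂)} := by
  simp only [le_negLog2_setQ, ofPred_forall]
  exact isClosed_iInter fun A => isClosed_iInter fun hA => isClosed_iInter fun B =>
    isClosed_iInter fun hB =>
      isClosed_le continuous_const (continuous_negLog2.comp (continuous_stateQ (h₁ hA) (h₂ hB)))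

theorem setQ_eq_zero (h₁ : C₁ ⊆ density κ) (h₂ : C₂ ⊆ density κ) {α : ℝ}
    (h : setQ α C₁ C₂ = 0) (β : ℝ) : setQ β C₁ C₂ = 0 := by
  simp only [setQ, ENNReal.iSup_eq_zero, stateQ_eq, ENNReal.ofReal_eq_zero] at h ⊢
  intro A hA B hB
  have hA' := (h₁ hA).1
  have hB' := (h₂ hB).1
  exact (realQ_eq_zero hA' hB' (le_antisymm (h A hA B hB) (realQ_nonneg hA' hB' α)) β).le

theorem negLog2_setQ_le_setC {α : ℝ} (hα : α ∈ Icc (0 : ℝ) 1) :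
    negLog2 (setQ α C₁ C₂) ≤ setC C₁ C₂ := by
  rw [negLog2_setQ]
  exact iInf₂_mono fun A _ => iInf₂_mono fun B _ =>
    le_iSup₂ (f := fun α (_ : α ∈ Icc (0 : ℝ) 1) => negLog2 (stateQ α A B)) α hα

/-- The single-copy minimax identity: the divergence of two convex sets is the maximum over `α` of
the logarithmic quasi-divergences. -/
theorem isGreatest_setC (h₁ : C₁ ⊆ density κ) (h₂ : C₂ ⊆ density κ) (hC₁ : Convex ℝ C₁)
    (hC₂ : Convex ℝ C₂) :
    IsGreatest ((fun α : ℝ => negLog2 (setQ α C₁ C₂)) '' Icc (0 : ℝ) 1) (setC C₁ C₂) := by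
  refine ⟨?_, by rintro _ ⟨α, hα, rfl⟩; exact negLog2_setQ_le_setC hα⟩
  -- The threshold for `Q_α` that corresponds to the value of the divergence.
  obtain ⟨V, hV⟩ := surjective_negLog2 (setC C₁ C₂)
  have hVle : ∀ x, setC C₁ C₂ ≤ negLog2 x ↔ x ≤ V := fun x => by
    rw [← hV, strictAnti_negLog2.le_iff_ge]
  suffices h : ∃ α ∈ Icc (0 : ℝ) 1, setC C₁ C₂ ≤ negLog2 (setQ α C₁ C₂) by
    obtain ⟨α, hα, h⟩ := h
    exact ⟨α, hα, le_antisymm (negLog2_setQ_le_setC hα) h⟩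
  simp_rw [le_negLog2_setQ, hVle]
  by_cases hVt : V = ⊤
  · exact ⟨0, by simp, fun _ _ _ _ => hVt ▸ le_top⟩
  have hreal : ∀ (α : ℝ) (A B : Matrix κ κ ℂ), stateQ α A B ≤ V ↔ realQ α A B ≤ V.toReal := by
    intro α A B
    rw [stateQ_eq, ENNReal.ofReal_le_iff_le_toReal hVt]
  simp only [hreal]
  obtain ⟨α, hα, h⟩ := exists_forall_le_of_convexOn_concaveOn (hC₁.prod hC₂)
    (f := fun α p => realQ α p.1 p.2) (v := V.toReal)
    (fun p hp => (continuous_realQ (h₁ hp.1).1 (h₂ hp.2).1).continuousOn)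
    (fun p hp => (convexOn_realQ (h₁ hp.1).1 (h₂ hp.2).1).subset (subset_univ _)
      (convex_Icc 0 1))
    (fun α hα => ⟨hC₁.prod hC₂, fun p hp p' hp' a b ha hb _ =>
      le_realQ_add_smul (h₁ hp.1).1 (h₂ hp.2).1 (h₁ hp'.1).1 (h₂ hp'.2).1 ha hb hα⟩)
    (fun p hp => by
      obtain ⟨α, hα, hmax⟩ := isCompact_Icc.exists_isMaxOn
        (nonempty_Icc.2 (zero_le_one (α := ℝ)))
        (continuous_negLog2.comp (continuous_stateQ (h₁ hp.1) (h₂ hp.2))).continuousOn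
      refine ⟨α, hα, ?_⟩
      rw [← hreal, ← hVle]
      have hle : setC C₁ C₂ ≤ stateC p.1 p.2 :=
        (iInf₂_le p.1 hp.1).trans (iInf₂_le p.2 hp.2)
      exact hle.trans (iSup₂_le fun β hβ => hmax hβ))
  exact ⟨α, hα, fun A hA B hB => h (A, B) ⟨hA, hB⟩⟩

end sets

end QChernoff

/-! ### Subadditive sequences -/

namespace QChernoff

section Fekete

variable {a : ℕ → ℝ≥0∞}

theorem apply_mul_le_of_subadditive (ha : ∀ n m, 1 ≤ n → 1 ≤ m → a (n + m) ≤ a n + a m) {n k : ℕ}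
    (hn : 1 ≤ n) (hk : 1 ≤ k) : a (k * n) ≤ k * a n := by
  induction k, hk using Nat.le_induction with
  | base => simp
  | succ k hk ih =>
    rw [Nat.add_mul, one_mul]
    refine (ha _ _ (Nat.mul_pos hk hn) hn).trans ?_
    rw [Nat.cast_add, Nat.cast_one, add_mul, one_mul]
    gcongr

theorem apply_mul_div_le_of_subadditive (ha : ∀ n m, 1 ≤ n → 1 ≤ m → a (n + m) ≤ a n + a m)
    {n k : ℕ} (hn : 1 ≤ n) (hk : 1 ≤ k) : a (k * n) / (k * n : ℕ) ≤ a n / n := by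
  refine (ENNReal.div_le_div_right (apply_mul_le_of_subadditive ha hn hk) _).trans ?_
  rw [Nat.cast_mul, ENNReal.mul_div_mul_left _ _ (by positivity) (ENNReal.natCast_ne_top k)]

/-- The lower-limit half of Fekete's lemma, which allows infinite terms: the values along the
multiples of `n` are at most the one at `n`. -/
theorem liminf_div_eq_iInf (ha : ∀ n m, 1 ≤ n → 1 ≤ m → a (n + m) ≤ a n + a m) :
    liminf (fun n => a n / n) atTop = ⨅ n : ℕ, ⨅ _ : 1 ≤ n, a n / n := by
  refine le_antisymm (le_iInf₂ fun n hn => ?_) ?_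
  · refine liminf_le_of_frequently_le (frequently_atTop.2 fun N => ⟨(N + 1) * n, ?_, ?_⟩)
    · nlinarith
    · exact apply_mul_div_le_of_subadditive ha hn (Nat.le_add_left 1 N)
  · exact le_liminf_of_le (h := (eventually_ge_atTop 1).mono fun n hn => iInf₂_le n hn)

/-- Fekete's lemma for sequences with values in `[0, ∞]` that are eventually finite. -/
theorem tendsto_div_of_eventually_ne_top (ha : ∀ n m, 1 ≤ n → 1 ≤ m → a (n + m) ≤ a n + a m)
    (hfin : ∀ᶠ n in atTop, a n ≠ ⊤) :
    Tendsto (fun n => a n / n) atTop (𝓝 (⨅ n : ℕ, ⨅ _ : 1 ≤ n, a n / n)) := by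
  refine tendsto_of_le_liminf_of_limsup_le (liminf_div_eq_iInf ha).ge ?_
  refine le_iInf₂ fun m hm => ?_
  by_cases hm' : a m = ⊤
  · rw [hm', ENNReal.top_div_of_ne_top (ENNReal.natCast_ne_top m)]
    exact le_top
  obtain ⟨N, hN⟩ := eventually_atTop.1 (hfin.and (eventually_ge_atTop 1))
  set M := ∑ r ∈ Finset.Ico N (N + m), a r
  have hM : M ≠ ⊤ := ENNReal.sum_ne_top.2 fun r hr => (hN r (Finset.mem_Ico.1 hr).1).1
  have hle : ∀ᶠ p : ℕ in atTop, a p / p ≤ a m / m + M / p := by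
    filter_upwards [eventually_ge_atTop (N + m)] with p hp
    -- Write `p = q * m + r` with `N ≤ r < N + m`, so that `a r` is finite and bounded by `M`.
    set q := (p - N) / m
    set r := N + (p - N) % m
    have hpq : p = q * m + r := by
      have h : q * m + (p - N) % m = p - N := Nat.div_add_mod' (p - N) m
      change p = q * m + (N + (p - N) % m)
      generalize q * m = x at h ⊢
      omega
    have hrM : a r ≤ M := Finset.single_le_sum (f := a) (fun _ _ => zero_le)
      (Finset.mem_Ico.2 ⟨Nat.le_add_right _ _, Nat.add_lt_add_left (Nat.mod_lt _ hm) N⟩)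
    have hq : 1 ≤ q := (Nat.one_le_div_iff hm).2 (by omega)
    have h1 : a p ≤ q * a m + M := by
      conv_lhs => rw [hpq]
      refine (ha _ _ (Nat.mul_pos hq hm) (hN r (Nat.le_add_right _ _)).2).trans ?_
      exact add_le_add (apply_mul_le_of_subadditive ha hm hq) hrM
    refine (ENNReal.div_le_div_right h1 _).trans ?_
    rw [ENNReal.add_div]
    refine add_le_add_left (ENNReal.div_le_of_le_mul ?_) _
    calc (q : ℝ≥0∞) * a m = a m / m * (q * m : ℕ) := by
          have hm0 : (m : ℝ≥0∞) ≠ 0 := by positivity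
          rw [Nat.cast_mul, mul_left_comm, ENNReal.div_mul_cancel hm0 (ENNReal.natCast_ne_top m)]
      _ ≤ a m / m * p := by
          gcongr
          omega
  have hlim : Tendsto (fun p : ℕ => a m / m + M / p) atTop (𝓝 (a m / m + 0)) :=
    tendsto_const_nhds.add (ENNReal.Tendsto.const_div ENNReal.tendsto_nat_nhds_top (Or.inr hM)
      |>.trans (by simp))
  rw [add_zero] at hlim
  exact (limsup_le_limsup hle).trans hlim.limsup_eq.le

/-- A minimax identity along a sequence: a compactness argument along the factorials, on which the
normalized subadditive sequences decrease. -/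
theorem exists_iInf_div_le_iInf_div {b : ℝ → ℕ → ℝ≥0∞} {K : Set ℝ} (hK : IsCompact K)
    (hb : ∀ α ∈ K, ∀ n m, 1 ≤ n → 1 ≤ m → b α (n + m) ≤ b α n + b α m)
    (hclosed : ∀ n, 1 ≤ n → ∀ c, IsClosed (K ∩ {α | c ≤ b α n}))
    (hattain : ∀ n, 1 ≤ n → ∃ α ∈ K, a n = b α n) :
    ∃ α ∈ K, (⨅ n : ℕ, ⨅ _ : 1 ≤ n, a n / n) ≤ ⨅ n : ℕ, ⨅ _ : 1 ≤ n, b α n / n := by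
  set c := ⨅ n : ℕ, ⨅ _ : 1 ≤ n, a n / n
  have hpos : ∀ k : ℕ, 1 ≤ k.factorial := fun k => k.factorial_pos
  have hset : ∀ n : ℕ, 1 ≤ n → K ∩ {α | c ≤ b α n / n} = K ∩ {α | c * n ≤ b α n} := by
    intro n hn
    ext α
    have hn0 : (n : ℝ≥0∞) ≠ 0 := by positivity
    simp only [mem_inter_iff, mem_ofPred_eq,
      ENNReal.le_div_iff_mul_le (Or.inl hn0) (Or.inl (ENNReal.natCast_ne_top n))]
  obtain ⟨α, hα⟩ := IsCompact.nonempty_iInter_of_sequence_nonempty_isCompact_isClosed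
    (fun k : ℕ => K ∩ {α | c ≤ b α k.factorial / k.factorial})
    (fun k α hα => ⟨hα.1, hα.2.trans
      (apply_mul_div_le_of_subadditive (hb α hα.1) (hpos k) (Nat.le_add_left 1 k))⟩)
    (fun k => by
      obtain ⟨α, hα, h⟩ := hattain _ (hpos k)
      refine ⟨α, hα, ?_⟩
      rw [mem_ofPred_eq, ← h]
      exact iInf₂_le k.factorial (hpos k))
    (hK.of_isClosed_subset (by rw [hset _ (hpos 0)]; exact hclosed _ (hpos 0) _)
      inter_subset_left)
    (fun k => by rw [hset _ (hpos k)]; exact hclosed _ (hpos k) _)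
  rw [mem_iInter] at hα
  refine ⟨α, (hα 0).1, le_iInf₂ fun n hn => (hα n).2.trans ?_⟩
  obtain ⟨k, hk⟩ := Nat.dvd_factorial hn le_rfl
  have hk1 : 1 ≤ k := Nat.pos_of_mul_pos_left (hk ▸ hpos n)
  rw [hk, mul_comm n k]
  exact apply_mul_div_le_of_subadditive (hb α (hα 0).1) hn hk1

end Fekete

/-! ### Stable sequences of sets -/

theorem coe_toENNReal_div {x : EReal} (hx : 0 ≤ x) {n : ℕ} (hn : 1 ≤ n) :
    ((x.toENNReal / n : ℝ≥0∞) : EReal) = x / n := by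
  have h : (((n : ℝ≥0∞)⁻¹ : ℝ≥0∞) : EReal) = (n : EReal)⁻¹ := by
    have hn' : (0 : ℝ) < n := by positivity
    rw [← ENNReal.ofReal_natCast, ← ENNReal.ofReal_inv_of_pos hn', EReal.coe_ennreal_ofReal,
      max_eq_left (by positivity), EReal.coe_inv]
    simp
  rw [div_eq_mul_inv, EReal.coe_ennreal_mul, EReal.coe_toENNReal hx, h, div_eq_mul_inv]

section sequences

variable {ι : Type*} [Fintype ι] [DecidableEq ι] {C₁ C₂ : (n : ℕ) → Set (PowMat ι n)} {α : ℝ}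

theorem setQ_mul_le (h₁ : ∀ n, 1 ≤ n → C₁ n ⊆ density (Fin n → ι))
    (h₂ : ∀ n, 1 ≤ n → C₂ n ⊆ density (Fin n → ι)) (hs₁ : Stable C₁) (hs₂ : Stable C₂) {n m : ℕ}
    (hn : 1 ≤ n) (hm : 1 ≤ m) :
    setQ α (C₁ n) (C₂ n) * setQ α (C₁ m) (C₂ m) ≤ setQ α (C₁ (n + m)) (C₂ (n + m)) := by
  simp only [setQ, ENNReal.iSup_mul, ENNReal.mul_iSup, iSup_le_iff]
  intro Y hY Y' hY' X hX X' hX'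
  have hmul : stateQ α X X' * stateQ α Y Y' = stateQ α (tensor X Y) (tensor X' Y') := by
    rw [stateQ_eq, stateQ_eq, stateQ_eq, realQ_tensor (h₁ n hn hX).1 (h₁ m hm hY).1
      (h₂ n hn hX').1 (h₂ m hm hY').1, ENNReal.ofReal_mul
      (realQ_nonneg (h₁ n hn hX).1 (h₂ n hn hX').1 α)]
  rw [hmul]
  exact le_iSup₂_of_le _ (hs₁ n m hn hm X hX Y hY)
    (le_iSup₂_of_le _ (hs₂ n m hn hm X' hX' Y' hY') le_rfl)

/-- The sequence `-log₂ Q_α(C₁ₙ‖C₂ₙ)` in `[0, ∞]`. For sets of density matrices and `α ∈ [0, 1]` it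
is nonnegative, so that nothing is lost by the truncation. -/
noncomputable def logQ (C₁ C₂ : (n : ℕ) → Set (PowMat ι n)) (α : ℝ) (n : ℕ) : ℝ≥0∞ :=
  (negLog2 (setQ α (C₁ n) (C₂ n))).toENNReal

/-- The sequence `C(C₁ₙ‖C₂ₙ)` in `[0, ∞]`, again with a truncation that is vacuous for sets of
density matrices. -/
noncomputable def chernoff (C₁ C₂ : (n : ℕ) → Set (PowMat ι n)) (n : ℕ) : ℝ≥0∞ :=
  (setC (C₁ n) (C₂ n)).toENNReal

theorem negLog2_setQ_nonneg (h₁ : ∀ n, 1 ≤ n → C₁ n ⊆ density (Fin n → ι))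
    (h₂ : ∀ n, 1 ≤ n → C₂ n ⊆ density (Fin n → ι)) (hα : α ∈ Icc (0 : ℝ) 1) {n : ℕ} (hn : 1 ≤ n) :
    0 ≤ negLog2 (setQ α (C₁ n) (C₂ n)) :=
  negLog2_nonneg (setQ_le_one (h₁ n hn) (h₂ n hn) hα)

theorem setC_nonneg (h₁ : ∀ n, 1 ≤ n → C₁ n ⊆ density (Fin n → ι))
    (h₂ : ∀ n, 1 ≤ n → C₂ n ⊆ density (Fin n → ι)) {n : ℕ} (hn : 1 ≤ n) : 0 ≤ setC (C₁ n) (C₂ n) :=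
  (negLog2_setQ_nonneg h₁ h₂ (left_mem_Icc.2 zero_le_one) hn).trans
    (negLog2_setQ_le_setC (left_mem_Icc.2 zero_le_one))

theorem negLog2_rateQ (h₁ : ∀ n, 1 ≤ n → C₁ n ⊆ density (Fin n → ι))
    (h₂ : ∀ n, 1 ≤ n → C₂ n ⊆ density (Fin n → ι)) (hα : α ∈ Icc (0 : ℝ) 1) {n : ℕ} (hn : 1 ≤ n) :
    negLog2 (rateQ α C₁ C₂ n) = ((logQ C₁ C₂ α n / n : ℝ≥0∞) : EReal) := by
  rw [rateQ, negLog2_rpow_one_div, logQ,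
    coe_toENNReal_div (negLog2_setQ_nonneg h₁ h₂ hα hn) hn]

theorem rateC_eq (h₁ : ∀ n, 1 ≤ n → C₁ n ⊆ density (Fin n → ι))
    (h₂ : ∀ n, 1 ≤ n → C₂ n ⊆ density (Fin n → ι)) {n : ℕ} (hn : 1 ≤ n) :
    rateC C₁ C₂ n = ((chernoff C₁ C₂ n / n : ℝ≥0∞) : EReal) := by
  rw [rateC, chernoff, coe_toENNReal_div (setC_nonneg h₁ h₂ hn) hn]

theorem logQ_add_le (h₁ : ∀ n, 1 ≤ n → C₁ n ⊆ density (Fin n → ι))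
    (h₂ : ∀ n, 1 ≤ n → C₂ n ⊆ density (Fin n → ι)) (hs₁ : Stable C₁) (hs₂ : Stable C₂)
    (hα : α ∈ Icc (0 : ℝ) 1) (n m : ℕ) (hn : 1 ≤ n) (hm : 1 ≤ m) :
    logQ C₁ C₂ α (n + m) ≤ logQ C₁ C₂ α n + logQ C₁ C₂ α m := by
  rw [logQ, logQ, logQ, ← EReal.toENNReal_add (negLog2_setQ_nonneg h₁ h₂ hα hn)
    (negLog2_setQ_nonneg h₁ h₂ hα hm), ← negLog2_mul (setQ_le_one (h₁ n hn) (h₂ n hn) hα)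
    (setQ_le_one (h₁ m hm) (h₂ m hm) hα)]
  exact EReal.toENNReal_le_toENNReal
    (strictAnti_negLog2.antitone (setQ_mul_le h₁ h₂ hs₁ hs₂ hn hm))

theorem logQ_le_chernoff (hα : α ∈ Icc (0 : ℝ) 1) (n : ℕ) : logQ C₁ C₂ α n ≤ chernoff C₁ C₂ n :=
  EReal.toENNReal_le_toENNReal (negLog2_setQ_le_setC hα)

end sequences
end QChernoff

/-! ### Regularization -/

namespace QChernoff

section regularization

variable {ι : Type*} [Fintype ι] [DecidableEq ι] {C₁ C₂ : (n : ℕ) → Set (PowMat ι n)} {α : ℝ}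

theorem exists_chernoff_eq_logQ (h₁ : ∀ n, 1 ≤ n → C₁ n ⊆ density (Fin n → ι))
    (h₂ : ∀ n, 1 ≤ n → C₂ n ⊆ density (Fin n → ι))
    (hC₁ : ∀ n, 1 ≤ n → Convex ℝ (C₁ n)) (hC₂ : ∀ n, 1 ≤ n → Convex ℝ (C₂ n)) {n : ℕ}
    (hn : 1 ≤ n) : ∃ α ∈ Icc (0 : ℝ) 1, chernoff C₁ C₂ n = logQ C₁ C₂ α n := by
  obtain ⟨α, hα, h⟩ := (isGreatest_setC (h₁ n hn) (h₂ n hn) (hC₁ n hn) (hC₂ n hn)).1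
  exact ⟨α, hα, congrArg EReal.toENNReal h.symm⟩

/-- Subadditivity of the divergence follows from that of the logarithmic quasi-divergences at an
optimal `α`. -/
theorem chernoff_add_le (h₁ : ∀ n, 1 ≤ n → C₁ n ⊆ density (Fin n → ι))
    (h₂ : ∀ n, 1 ≤ n → C₂ n ⊆ density (Fin n → ι))
    (hC₁ : ∀ n, 1 ≤ n → Convex ℝ (C₁ n)) (hC₂ : ∀ n, 1 ≤ n → Convex ℝ (C₂ n))
    (hs₁ : Stable C₁) (hs₂ : Stable C₂) (n m : ℕ) (hn : 1 ≤ n) (hm : 1 ≤ m) :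
    chernoff C₁ C₂ (n + m) ≤ chernoff C₁ C₂ n + chernoff C₁ C₂ m := by
  obtain ⟨α, hα, h⟩ := exists_chernoff_eq_logQ h₁ h₂ hC₁ hC₂ (Nat.le_add_right_of_le hn (k := m))
  rw [h]
  exact (logQ_add_le h₁ h₂ hs₁ hs₂ hα n m hn hm).trans
    (add_le_add (logQ_le_chernoff hα n) (logQ_le_chernoff hα m))

/-- An infinite divergence means that `Q_α` vanishes at one `α`, hence at all of them. -/
theorem logQ_eq_top_of_chernoff_eq_top (h₁ : ∀ n, 1 ≤ n → C₁ n ⊆ density (Fin n → ι))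
    (h₂ : ∀ n, 1 ≤ n → C₂ n ⊆ density (Fin n → ι))
    (hC₁ : ∀ n, 1 ≤ n → Convex ℝ (C₁ n)) (hC₂ : ∀ n, 1 ≤ n → Convex ℝ (C₂ n)) {n : ℕ}
    (hn : 1 ≤ n) (h : chernoff C₁ C₂ n = ⊤) (α : ℝ) : logQ C₁ C₂ α n = ⊤ := by
  obtain ⟨β, hβ, h'⟩ := exists_chernoff_eq_logQ h₁ h₂ hC₁ hC₂ hn
  rw [h] at h'
  have h0 := negLog2_eq_top.1 (EReal.toENNReal_eq_top_iff.1 h'.symm)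
  rw [logQ, setQ_eq_zero (h₁ n hn) (h₂ n hn) h0 α, negLog2_zero, EReal.toENNReal_top]

theorem coe_liminf (a : ℕ → ℝ≥0∞) :
    ((liminf a atTop : ℝ≥0∞) : EReal) = liminf (fun n => (a n : EReal)) atTop :=
  Monotone.map_liminf_of_continuousAt (fun _ _ h => EReal.coe_ennreal_le_coe_ennreal_iff.2 h) a
    continuous_coe_ennreal_ereal.continuousAt

theorem lowerRegC_eq (h₁ : ∀ n, 1 ≤ n → C₁ n ⊆ density (Fin n → ι))
    (h₂ : ∀ n, 1 ≤ n → C₂ n ⊆ density (Fin n → ι))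
    (hC₁ : ∀ n, 1 ≤ n → Convex ℝ (C₁ n)) (hC₂ : ∀ n, 1 ≤ n → Convex ℝ (C₂ n))
    (hs₁ : Stable C₁) (hs₂ : Stable C₂) :
    lowerRegC C₁ C₂ = ((⨅ n : ℕ, ⨅ _ : 1 ≤ n, chernoff C₁ C₂ n / n : ℝ≥0∞) : EReal) := by
  rw [← liminf_div_eq_iInf (chernoff_add_le h₁ h₂ hC₁ hC₂ hs₁ hs₂), coe_liminf]
  exact liminf_congr ((eventually_ge_atTop 1).mono fun n hn => rateC_eq h₁ h₂ hn)

theorem negLog2_upperRegQ (h₁ : ∀ n, 1 ≤ n → C₁ n ⊆ density (Fin n → ι))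
    (h₂ : ∀ n, 1 ≤ n → C₂ n ⊆ density (Fin n → ι)) (hs₁ : Stable C₁) (hs₂ : Stable C₂)
    (hα : α ∈ Icc (0 : ℝ) 1) :
    negLog2 (upperRegQ α C₁ C₂)
      = ((⨅ n : ℕ, ⨅ _ : 1 ≤ n, logQ C₁ C₂ α n / n : ℝ≥0∞) : EReal) := by
  rw [← liminf_div_eq_iInf (logQ_add_le h₁ h₂ hs₁ hs₂ hα), coe_liminf, upperRegQ, negLog2_limsup]
  exact liminf_congr ((eventually_ge_atTop 1).mono fun n hn => negLog2_rateQ h₁ h₂ hα hn)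

/-- The formula for the lower and upper regularizations, which holds without any finiteness. -/
theorem isGreatest_lowerRegC (h₁ : ∀ n, 1 ≤ n → C₁ n ⊆ density (Fin n → ι))
    (h₂ : ∀ n, 1 ≤ n → C₂ n ⊆ density (Fin n → ι))
    (hC₁ : ∀ n, 1 ≤ n → Convex ℝ (C₁ n)) (hC₂ : ∀ n, 1 ≤ n → Convex ℝ (C₂ n))
    (hs₁ : Stable C₁) (hs₂ : Stable C₂) :
    IsGreatest ((fun α : ℝ => negLog2 (upperRegQ α C₁ C₂)) '' Icc (0 : ℝ) 1)
      (lowerRegC C₁ C₂) := by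
  have hle : ∀ α ∈ Icc (0 : ℝ) 1, negLog2 (upperRegQ α C₁ C₂) ≤ lowerRegC C₁ C₂ := by
    intro α hα
    rw [lowerRegC_eq h₁ h₂ hC₁ hC₂ hs₁ hs₂, negLog2_upperRegQ h₁ h₂ hs₁ hs₂ hα,
      EReal.coe_ennreal_le_coe_ennreal_iff]
    exact iInf₂_mono fun n _ => ENNReal.div_le_div_right (logQ_le_chernoff hα n) _
  refine ⟨?_, by rintro _ ⟨α, hα, rfl⟩; exact hle α hα⟩
  obtain ⟨α, hα, h⟩ := exists_iInf_div_le_iInf_div (a := chernoff C₁ C₂)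
    (b := logQ C₁ C₂) (isCompact_Icc (a := (0 : ℝ)) (b := 1))
    (fun α hα => logQ_add_le h₁ h₂ hs₁ hs₂ hα)
    (fun n hn c => by
      have : Icc (0 : ℝ) 1 ∩ {α | c ≤ logQ C₁ C₂ α n}
          = Icc (0 : ℝ) 1 ∩ {α | (c : EReal) ≤ negLog2 (setQ α (C₁ n) (C₂ n))} := by
        ext α
        refine and_congr_right fun hα => ?_
        rw [mem_ofPred_eq, mem_ofPred_eq, ← EReal.coe_ennreal_le_coe_ennreal_iff, logQ,
          EReal.coe_toENNReal (negLog2_setQ_nonneg h₁ h₂ hα hn)]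
      rw [this]
      exact isClosed_Icc.inter (isClosed_le_negLog2_setQ (h₁ n hn) (h₂ n hn) _))
    (fun n hn => exists_chernoff_eq_logQ h₁ h₂ hC₁ hC₂ hn)
  refine ⟨α, hα, le_antisymm (hle α hα) ?_⟩
  dsimp only
  rw [lowerRegC_eq h₁ h₂ hC₁ hC₂ hs₁ hs₂, negLog2_upperRegQ h₁ h₂ hs₁ hs₂ hα]
  exact EReal.coe_ennreal_le_coe_ennreal_iff.2 h

theorem exists_isRegC_iff (h₁ : ∀ n, 1 ≤ n → C₁ n ⊆ density (Fin n → ι))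
    (h₂ : ∀ n, 1 ≤ n → C₂ n ⊆ density (Fin n → ι))
    (hC₁ : ∀ n, 1 ≤ n → Convex ℝ (C₁ n)) (hC₂ : ∀ n, 1 ≤ n → Convex ℝ (C₂ n))
    (hs₁ : Stable C₁) (hs₂ : Stable C₂) :
    (∃ L, IsRegC C₁ C₂ L) ↔ ((∀ᶠ n in atTop, setC (C₁ n) (C₂ n) ≠ ⊤) ∨
      (∀ n, 1 ≤ n → setC (C₁ n) (C₂ n) = ⊤)) := by
  have hadd := chernoff_add_le h₁ h₂ hC₁ hC₂ hs₁ hs₂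
  constructor
  · rintro ⟨L, hL⟩
    by_contra! hcon
    obtain ⟨hfreq, n, hn, hfin⟩ := hcon
    -- The limit is the infimum, hence finite, and so are eventually the terms.
    have hlt : L < ⊤ := by
      rw [← hL.liminf_eq, ← lowerRegC, lowerRegC_eq h₁ h₂ hC₁ hC₂ hs₁ hs₂, lt_top_iff_ne_top,
        Ne, EReal.coe_ennreal_eq_top_iff, ← Ne, ← lt_top_iff_ne_top]
      refine (iInf₂_le n hn).trans_lt (ENNReal.div_lt_top ?_ (by positivity))
      rwa [chernoff, EReal.toENNReal_ne_top_iff]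
    obtain ⟨m, hm, hm1, hlt'⟩ := (hfreq.and_eventually ((eventually_ge_atTop 1).and
      (hL.eventually_lt_const hlt))).exists
    rw [rateC, hm, EReal.top_div_of_pos_ne_top (by exact_mod_cast hm1) (EReal.natCast_ne_top m)]
      at hlt'
    exact lt_irrefl _ hlt'
  · rintro (hfin | htop)
    · refine ⟨_, Tendsto.congr' ((eventually_ge_atTop 1).mono fun n hn =>
        (rateC_eq h₁ h₂ hn).symm) (EReal.tendsto_coe_ennreal.2
        (tendsto_div_of_eventually_ne_top hadd ?_))⟩
      exact hfin.mono fun n hn => by rwa [chernoff, EReal.toENNReal_ne_top_iff]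
    · refine ⟨⊤, tendsto_const_nhds.congr' ((eventually_ge_atTop 1).mono fun n hn => ?_)⟩
      rw [rateC, htop n hn,
        EReal.top_div_of_pos_ne_top (by exact_mod_cast hn) (EReal.natCast_ne_top n)]

/-- If the limit of the divergences exists, these are eventually finite, so that Fekete's lemma
applies to each `-log₂ Q_α`, or all infinite, and then all `Q_α` vanish. -/
theorem isRegQ_upperRegQ (h₁ : ∀ n, 1 ≤ n → C₁ n ⊆ density (Fin n → ι))
    (h₂ : ∀ n, 1 ≤ n → C₂ n ⊆ density (Fin n → ι))
    (hC₁ : ∀ n, 1 ≤ n → Convex ℝ (C₁ n)) (hC₂ : ∀ n, 1 ≤ n → Convex ℝ (C₂ n))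
    (hs₁ : Stable C₁) (hs₂ : Stable C₂) {L : EReal} (hL : IsRegC C₁ C₂ L)
    (hα : α ∈ Icc (0 : ℝ) 1) : IsRegQ α C₁ C₂ (upperRegQ α C₁ C₂) := by
  have hlim : Tendsto (fun n => logQ C₁ C₂ α n / n) atTop
      (𝓝 (⨅ n : ℕ, ⨅ _ : 1 ≤ n, logQ C₁ C₂ α n / n)) := by
    rcases (exists_isRegC_iff h₁ h₂ hC₁ hC₂ hs₁ hs₂).1 ⟨L, hL⟩ with hfin | htop
    · refine tendsto_div_of_eventually_ne_top (logQ_add_le h₁ h₂ hs₁ hs₂ hα) ?_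
      refine hfin.mono fun n hn => ne_top_of_le_ne_top ?_ (logQ_le_chernoff hα n)
      rwa [chernoff, EReal.toENNReal_ne_top_iff]
    · have hall : ∀ n : ℕ, 1 ≤ n → logQ C₁ C₂ α n / n = ⊤ := fun n hn => by
        rw [logQ_eq_top_of_chernoff_eq_top h₁ h₂ hC₁ hC₂ hn
          (by rw [chernoff, htop n hn, EReal.toENNReal_top]),
          ENNReal.top_div_of_ne_top (ENNReal.natCast_ne_top n)]
      rw [show (⨅ n : ℕ, ⨅ _ : 1 ≤ n, logQ C₁ C₂ α n / n) = ⊤ by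
        simpa only [iInf_eq_top] using hall]
      exact tendsto_const_nhds.congr' ((eventually_ge_atTop 1).mono fun n hn => (hall n hn).symm)
  have h : Tendsto (fun n => negLog2 (rateQ α C₁ C₂ n)) atTop
      (𝓝 (negLog2 (upperRegQ α C₁ C₂))) := by
    rw [negLog2_upperRegQ h₁ h₂ hs₁ hs₂ hα]
    exact (EReal.tendsto_coe_ennreal.2 hlim).congr'
      ((eventually_ge_atTop 1).mono fun n hn => (negLog2_rateQ h₁ h₂ hα hn).symm)
  have hcont := (negLog2Iso.symm.continuous.comp continuous_toDual).tendsto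
    (negLog2 (upperRegQ α C₁ C₂))
  simpa [IsRegQ, Function.comp_def, negLog2_eq] using hcont.comp h

end regularization

end QChernoff

theorem mainTheorem5 {ι : Type*} [Fintype ι] [DecidableEq ι] :
    (∀ C₁ C₂ : Set (Matrix ι ι ℂ),
      C₁ ⊆ QChernoff.density ι → C₂ ⊆ QChernoff.density ι →
      Convex ℝ C₁ → Convex ℝ C₂ →
      IsGreatest ((fun α : ℝ => QChernoff.negLog2 (QChernoff.setQ α C₁ C₂)) '' Icc (0 : ℝ) 1)
        (QChernoff.setC C₁ C₂)) ∧
    (∀ C₁ C₂ : (n : ℕ) → Set (QChernoff.PowMat ι n),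
      (∀ n, 1 ≤ n → C₁ n ⊆ QChernoff.density (Fin n → ι)) →
      (∀ n, 1 ≤ n → C₂ n ⊆ QChernoff.density (Fin n → ι)) →
      (∀ n, 1 ≤ n → Convex ℝ (C₁ n)) → (∀ n, 1 ≤ n → Convex ℝ (C₂ n)) →
      QChernoff.Stable C₁ → QChernoff.Stable C₂ →
      -- existence of the regularized divergence
      ((∃ L, QChernoff.IsRegC C₁ C₂ L) ↔
        ((∀ᶠ n in atTop, QChernoff.setC (C₁ n) (C₂ n) ≠ ⊤) ∨
          (∀ n, 1 ≤ n → QChernoff.setC (C₁ n) (C₂ n) = ⊤))) ∧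
      -- whenever it exists, so do all regularized quasi-divergences, and the formula holds
      (∀ L, QChernoff.IsRegC C₁ C₂ L →
        ∃ q : ℝ → ℝ≥0∞, (∀ α ∈ Icc (0 : ℝ) 1, QChernoff.IsRegQ α C₁ C₂ (q α)) ∧
          IsGreatest ((fun α : ℝ => QChernoff.negLog2 (q α)) '' Icc (0 : ℝ) 1) L) ∧
      -- in all cases the formula holds for the lower and upper regularizations
      IsGreatest ((fun α : ℝ => QChernoff.negLog2 (QChernoff.upperRegQ α C₁ C₂)) '' Icc (0 : ℝ) 1)
        (QChernoff.lowerRegC C₁ C₂)) := by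
  refine ⟨fun C₁ C₂ h₁ h₂ hC₁ hC₂ => QChernoff.isGreatest_setC h₁ h₂ hC₁ hC₂,
    fun C₁ C₂ h₁ h₂ hC₁ hC₂ hs₁ hs₂ => ?_⟩
  have hlower := QChernoff.isGreatest_lowerRegC h₁ h₂ hC₁ hC₂ hs₁ hs₂
  refine ⟨QChernoff.exists_isRegC_iff h₁ h₂ hC₁ hC₂ hs₁ hs₂, fun L hL => ?_, hlower⟩
  refine ⟨fun α => QChernoff.upperRegQ α C₁ C₂, fun α hα =>
    QChernoff.isRegQ_upperRegQ h₁ h₂ hC₁ hC₂ hs₁ hs₂ hL hα, ?_⟩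
  rwa [QChernoff.lowerRegC, hL.liminf_eq] at hlower
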